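/- Let $\gamma\subset\mathbb{C}$ be a closed rectifiable Jordan curve. For $\xi\in\gamma$ let $V_\gamma[\arg(t-\xi)]$ denote the total variation, along the open arc $\gamma\setminus\{\xi\}$, of a continuous branch of the argument of $t-\xi$, $t\in\gamma\setminus\{\xi\}$ (it does not depend on the branch). Call $\gamma$ a Král curve if $$\sup_{\xi\in\gamma}V_\gamma[\arg(t-\xi)]<\infty .$$ Then every Král curve is Ahlfors-regular, i.e. $$\theta(\varepsilon):=\sup_{\xi\in\gamma}\operatorname{mes}\{t\in\gamma : |t-\xi|\le\varepsilon\}=O(\varepsilon),\qquad \varepsilon\to 0^+,$$ where $\operatorname{mes}$ is the linear Lebesgue measure (arc length) on $\gamma$. -/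

import Mathlib

open Set Filter Topology MeasureTheory
open scoped ENNReal NNReal

/-- `γ : ℝ → ℂ` is a (`1`-periodic) parametrization of a closed rectifiable Jordan curve in `ℂ`:
it is continuous, injective on a period, and its length is finite.
The curve itself is the set `range γ`. -/
structure IsRectifiableJordanCurve (γ : ℝ → ℂ) : Prop where
  continuous : Continuous γ
  periodic : Function.Periodic γ 1
  injOn : InjOn γ (Ico 0 1)
  rectifiable : eVariationOn γ (Icc 0 1) ≠ ⊤

/-- With `ξ = γ s`, the open arc `γ \ {ξ}` is parametrized by `t ∈ (s, s + 1)`.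
`IsArgBranch γ s θ` says that `t ↦ θ t` is a continuous branch of the multivalued function
`Arg (γ t - ξ)` on this arc. -/
structure IsArgBranch (γ : ℝ → ℂ) (s : ℝ) (θ : ℝ → ℝ) : Prop where
  continuousOn : ContinuousOn θ (Ioo s (s + 1))
  eq_polar : ∀ t ∈ Ioo s (s + 1),
    γ t - γ s = (‖γ t - γ s‖ : ℂ) * Complex.exp ((θ t : ℂ) * Complex.I)

/-- The variation `V_γ[arg(t - ξ)]` on `γ \ {ξ}`, where `ξ = γ s`. For a closed Jordan curve a
continuous branch exists and all branches have the same variation, so the infimum just picks that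
common value: this is proved below. -/
noncomputable def argVariation (γ : ℝ → ℂ) (s : ℝ) : ℝ≥0∞ :=
  ⨅ (θ : ℝ → ℝ) (_ : IsArgBranch γ s θ), eVariationOn θ (Ioo s (s + 1))

theorem IsRectifiableJordanCurve.apply_ne {γ : ℝ → ℂ} (h : IsRectifiableJordanCurve γ) {s t : ℝ}
    (ht : t ∈ Ioo s (s + 1)) : γ t ≠ γ s := by
  intro heq
  have key : ∀ x : ℝ, γ (Int.fract x) = γ x := by
    intro x
    have h1 := h.periodic.sub_zsmul_eq (x := x) ⌊x⌋
    rw [zsmul_one] at h1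
    exact h1
  have h2 : Int.fract t = Int.fract s :=
    h.injOn ⟨Int.fract_nonneg t, Int.fract_lt_one t⟩ ⟨Int.fract_nonneg s, Int.fract_lt_one s⟩
      (by rw [key, key, heq])
  obtain ⟨z, hz⟩ := Int.fract_eq_fract.mp h2
  have h3 : (0 : ℝ) < z := by rw [← hz]; linarith [ht.1]
  have h4 : (z : ℝ) < 1 := by rw [← hz]; linarith [ht.2]
  norm_cast at h3 h4
  omega

/-- Continuous branches of the argument exist. -/
theorem IsRectifiableJordanCurve.exists_isArgBranch {γ : ℝ → ℂ} (h : IsRectifiableJordanCurve γ)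
    (s : ℝ) : ∃ θ, IsArgBranch γ s θ := by
  have hne : (Ioo s (s + 1)).Nonempty := ⟨s + 1 / 2, by constructor <;> linarith⟩
  have hU : IsSimplyConnected (Ioo s (s + 1)) := by
    have := (convex_Ioo s (s + 1)).contractibleSpace hne
    exact SimplyConnectedSpace.ofContractible _
  obtain ⟨f, hf, hfe⟩ := Complex.exists_continuousOn_eqOn_exp_comp hU isOpen_Ioo
    (g := fun t => γ t - γ s) (h.continuous.sub continuous_const).continuousOn
    (by rintro ⟨t, ht, h0⟩; exact h.apply_ne ht (sub_eq_zero.mp h0))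
  refine ⟨fun t => (f t).im, Complex.continuous_im.comp_continuousOn hf, fun t ht => ?_⟩
  have h1 : Complex.exp (f t) = γ t - γ s := hfe ht
  rw [← h1, Complex.norm_exp, Complex.ofReal_exp, ← Complex.exp_add, Complex.re_add_im]

/-- Any two continuous branches of the argument have the same variation. -/
theorem IsArgBranch.eVariationOn_eq {γ : ℝ → ℂ} (h : IsRectifiableJordanCurve γ) {s : ℝ}
    {θ₁ θ₂ : ℝ → ℝ} (h₁ : IsArgBranch γ s θ₁) (h₂ : IsArgBranch γ s θ₂) :
    eVariationOn θ₁ (Ioo s (s + 1)) = eVariationOn θ₂ (Ioo s (s + 1)) := by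
  have hint : ∀ t ∈ Ioo s (s + 1), ∃ n : ℤ, (n : ℝ) = (θ₁ t - θ₂ t) / (2 * Real.pi) := by
    intro t ht
    have h0 : (‖γ t - γ s‖ : ℂ) ≠ 0 := by
      simpa [sub_eq_zero] using h.apply_ne ht
    have he := mul_left_cancel₀ h0 ((h₁.eq_polar t ht).symm.trans (h₂.eq_polar t ht))
    obtain ⟨n, hn⟩ := Complex.exp_eq_exp_iff_exists_int.mp he
    refine ⟨n, ?_⟩
    have hn' := congrArg Complex.im hn
    simp at hn'
    rw [eq_div_iff (by positivity)]
    linarith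
  have hcont : ContinuousOn (fun t => (θ₁ t - θ₂ t) / (2 * Real.pi)) (Ioo s (s + 1)) :=
    (h₁.continuousOn.sub h₂.continuousOn).div_const _
  have hconst : ∀ x ∈ Ioo s (s + 1), ∀ y ∈ Ioo s (s + 1), θ₁ x - θ₂ x = θ₁ y - θ₂ y := by
    intro x hx y hy
    have := isPreconnected_Ioo.constant_of_mapsTo (T := range ((↑) : ℤ → ℝ))
      Int.isClosedEmbedding_coe_real.isDiscrete_range hcont
      (fun t ht => hint t ht) hx hy
    field_simp at this
    exact this
  unfold eVariationOn
  refine iSup_congr fun p => Finset.sum_congr rfl fun i _ => ?_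
  have := hconst _ (p.2.2.2 (i + 1)) _ (p.2.2.2 i)
  rw [edist_dist, edist_dist, Real.dist_eq, Real.dist_eq]
  congr 2
  linarith

/-- `argVariation` is the variation of any continuous branch of the argument. -/
theorem IsArgBranch.argVariation_eq {γ : ℝ → ℂ} (h : IsRectifiableJordanCurve γ) {s : ℝ}
    {θ : ℝ → ℝ} (hθ : IsArgBranch γ s θ) :
    argVariation γ s = eVariationOn θ (Ioo s (s + 1)) :=
  le_antisymm (iInf₂_le θ hθ) (le_iInf₂ fun _ hθ' => (hθ.eVariationOn_eq h hθ').le)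

/-- The condition defining Král curves: `sup_{ξ ∈ γ} V_γ[arg(t - ξ)] < ∞`. -/
def KralCondition (γ : ℝ → ℂ) : Prop :=
  ⨆ s : ℝ, argVariation γ s < ⊤

/-- The arc coordinate of the point `γ t`, `0 ≤ t ≤ 1`: the length of the arc from `γ 0` to
`γ t`. -/
noncomputable def arcCoord (γ : ℝ → ℂ) (t : ℝ) : ℝ :=
  (eVariationOn γ (Icc 0 t)).toReal

/-- The linear Lebesgue measure (arc length) `mes {p ∈ γ : p ∈ E}` of the part of the curve lying
in `E`: the Lebesgue measure of the set of arc coordinates of its points. -/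
noncomputable def arcMes (γ : ℝ → ℂ) (E : Set ℂ) : ℝ≥0∞ :=
  volume (arcCoord γ '' {t ∈ Ico (0 : ℝ) 1 | γ t ∈ E})

/-- `θ(ε) = sup_{ξ ∈ γ} mes {p ∈ γ : |p - ξ| ≤ ε}`. -/
noncomputable def arcTheta (γ : ℝ → ℂ) (ε : ℝ) : ℝ≥0∞ :=
  ⨆ ξ ∈ range γ, arcMes γ {p | ‖p - ξ‖ ≤ ε}

/-- Ahlfors regularity: `θ(ε) = O(ε)` as `ε → 0+`. -/
def AhlforsRegular (γ : ℝ → ℂ) : Prop :=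
  ∃ C : ℝ≥0, ∀ᶠ ε : ℝ in 𝓝[>] 0, arcTheta γ ε ≤ C * ENNReal.ofReal ε

/-! The Král condition bounds the variation of the argument seen from points of the curve. The same
kind of bound, `K = 6 * M + 8 * π + 4`, is transferred to every viewpoint off the curve, and two
such viewpoints then control length.

Fix a uniform partition of the parameter interval. If `z` is off the curve with nearest point `w` on
it, the arguments of `p - z` and `p - w` differ, up to a constant along the arc, by the angle under
which `p` sees the segment from `z` to `w`. That angle is at most `π / 2`, and it is tiny at every
partition point far from `w` compared with `|w - z|`. Hence for `z` close to the curve the sum of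
argument increments is at most `K` (`exists_sum_le_of_near`); how close depends on the partition,
but `K` does not. Near infinity the sum is at most 2. With the signs of the increments frozen, the
sum is a harmonic function of the viewpoint, so the maximum principle gives `K` everywhere off the
curve (`sum_abs_im_sub_le_of_notMem`), and refining the partition bounds the total variation.

Finally, place two viewpoints at distance about `8 * ε` from `ξ` in perpendicular directions. Inside
the ball of radius `2 * ε` around `ξ`, a displacement is at most `72 * ε` times the sum of the two
argument increments (`norm_sub_le_of_two_viewpoints`). Summing over small arcs bounds the length in
the `ε`-ball by `144 * K * ε`. -/

/-! ### Branches of the logarithm along the curve -/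

/-- `l` is a continuous branch of the logarithm of `g` on `S`. -/
structure IsLogBranch (g : ℝ → ℂ) (S : Set ℝ) (l : ℝ → ℂ) : Prop where
  continuousOn : ContinuousOn l S
  exp_eq : ∀ t ∈ S, Complex.exp (l t) = g t

theorem IsLogBranch.mono {g : ℝ → ℂ} {S T : Set ℝ} {l : ℝ → ℂ} (h : IsLogBranch g S l)
    (hT : T ⊆ S) : IsLogBranch g T l :=
  ⟨h.continuousOn.mono hT, fun t ht => h.exp_eq t (hT ht)⟩

theorem exists_isLogBranch {g : ℝ → ℂ} {S : Set ℝ} (hS : Convex ℝ S) (hSo : IsOpen S)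
    (hne : S.Nonempty) (hg : ContinuousOn g S) (h0 : ∀ t ∈ S, g t ≠ 0) :
    ∃ l, IsLogBranch g S l := by
  have hU : IsSimplyConnected S := by
    have := hS.contractibleSpace hne
    exact SimplyConnectedSpace.ofContractible _
  obtain ⟨f, hf, hfe⟩ := Complex.exists_continuousOn_eqOn_exp_comp hU hSo hg
    (by rintro ⟨t, ht, h⟩; exact h0 t ht h)
  exact ⟨f, hf, fun t ht => hfe ht⟩

/-- The difference is continuous where the principal logarithm is, and takes values in the discrete
set of integer multiples of `2πi`. -/
theorem sub_log_exp_const {S : Set ℝ} (hS : IsPreconnected S) {c : ℝ → ℂ} (hc : ContinuousOn c S)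
    (hs : ∀ t ∈ S, Complex.exp (c t) ∈ Complex.slitPlane) {x y : ℝ} (hx : x ∈ S) (hy : y ∈ S) :
    c x - Complex.log (Complex.exp (c x)) = c y - Complex.log (Complex.exp (c y)) := by
  have hI : (2 * Real.pi * Complex.I : ℂ) ≠ 0 := Complex.two_pi_I_ne_zero
  have hint : ∀ t : ℝ, ∃ n : ℤ,
      c t - Complex.log (Complex.exp (c t)) = n * (2 * Real.pi * Complex.I) := by
    intro t
    obtain ⟨n, hn⟩ := Complex.exp_eq_exp_iff_exists_int.mp
      (Complex.exp_log (Complex.exp_ne_zero (c t))).symm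
    exact ⟨n, by rw [sub_eq_iff_eq_add, add_comm]; exact hn⟩
  have hcont : ContinuousOn
      (fun t => ((c t - Complex.log (Complex.exp (c t))) / (2 * Real.pi * Complex.I)).re) S :=
    Complex.continuous_re.comp_continuousOn
      ((hc.sub ((Complex.continuous_exp.comp_continuousOn hc).clog hs)).div_const _)
  have hre := hS.constant_of_mapsTo (T := range ((↑) : ℤ → ℝ))
    Int.isClosedEmbedding_coe_real.isDiscrete_range hcont
    (fun t _ => by
      obtain ⟨n, hn⟩ := hint t
      refine ⟨n, ?_⟩
      simp only [hn, mul_div_cancel_right₀ _ hI, Complex.intCast_re]) hx hy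
  obtain ⟨n, hn⟩ := hint x
  obtain ⟨m, hm⟩ := hint y
  simp only [hn, hm, mul_div_cancel_right₀ _ hI, Complex.intCast_re, Int.cast_inj] at hre
  rw [hn, hm, hre]

theorem IsLogBranch.sub_sub_log_const {f g a b : ℝ → ℂ} {S : Set ℝ} (ha : IsLogBranch f S a)
    (hb : IsLogBranch g S b) (hS : IsPreconnected S)
    (hs : ∀ t ∈ S, f t / g t ∈ Complex.slitPlane) {x y : ℝ} (hx : x ∈ S) (hy : y ∈ S) :
    a x - b x - Complex.log (f x / g x) = a y - b y - Complex.log (f y / g y) := by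
  have he : ∀ t ∈ S, Complex.exp (a t - b t) = f t / g t := fun t ht => by
    rw [Complex.exp_sub, ha.exp_eq t ht, hb.exp_eq t ht]
  have := sub_log_exp_const hS (ha.continuousOn.sub hb.continuousOn)
    (fun t ht => by rw [Pi.sub_apply, he t ht]; exact hs t ht) hx hy
  simpa only [Pi.sub_apply, he x hx, he y hy] using this

theorem IsLogBranch.abs_im_sub_le {f g a b : ℝ → ℂ} {S : Set ℝ} (ha : IsLogBranch f S a)
    (hb : IsLogBranch g S b) (hS : IsPreconnected S)
    (hs : ∀ t ∈ S, f t / g t ∈ Complex.slitPlane) {x y : ℝ} (hx : x ∈ S) (hy : y ∈ S) :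
    |(b x).im - (b y).im| ≤
      |(a x).im - (a y).im| + |Complex.arg (f x / g x)| + |Complex.arg (f y / g y)| := by
  have h := congrArg Complex.im (ha.sub_sub_log_const hb hS hs hx hy)
  simp only [Complex.sub_im, Complex.log_im] at h
  have : (b x).im - (b y).im = ((a x).im - (a y).im) - Complex.arg (f x / g x)
      + Complex.arg (f y / g y) := by linarith
  rw [this]
  exact (abs_add_le _ _).trans (add_le_add_left (abs_sub _ _) _)

/-- Nothing relates the branches `L w` for different `w`, but the increment does not depend on the
branch. For `w` near `z` it changes by principal logarithms of `(γ t - w) / (γ t - z)`, which lies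
within distance 1 of 1. -/
theorem differentiableAt_logBranch_sub {γ : ℝ → ℂ} {L : ℂ → ℝ → ℂ} {z : ℂ}
    (hc : IsClosed (range γ))
    (hL : ∀ w ∉ range γ, IsLogBranch (fun t => γ t - w) univ (L w)) (hz : z ∉ range γ) (a b : ℝ) :
    DifferentiableAt ℂ (fun w => L w b - L w a) z := by
  obtain ⟨r, hr, hball⟩ := Metric.isOpen_iff.mp hc.isOpen_compl z hz
  have hdist : ∀ t, r ≤ ‖γ t - z‖ := fun t => by
    by_contra! h
    exact hball (by rwa [Metric.mem_ball, dist_eq_norm]) ⟨t, rfl⟩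
  have hslit : ∀ w ∈ Metric.ball z r, ∀ t, (γ t - w) / (γ t - z) ∈ Complex.slitPlane := by
    intro w hw t
    have h0 : γ t - z ≠ 0 := norm_pos_iff.mp (hr.trans_le (hdist t))
    have h1 : (γ t - w) / (γ t - z) = 1 + (z - w) / (γ t - z) := by
      field_simp; ring
    rw [h1]
    apply Complex.mem_slitPlane_of_norm_lt_one
    rw [norm_div, div_lt_one (norm_pos_iff.mpr h0)]
    rw [Metric.mem_ball', dist_eq_norm] at hw
    exact hw.trans_le (hdist t)
  have key : (fun w => L w b - L w a) =ᶠ[𝓝 z] fun w => L z b - L z a +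
      (Complex.log ((γ b - w) / (γ b - z)) - Complex.log ((γ a - w) / (γ a - z))) := by
    filter_upwards [Metric.ball_mem_nhds z hr] with w hw
    have := (hL w (hball hw)).sub_sub_log_const (hL z hz) isPreconnected_univ
      (fun t _ => hslit w hw t) (mem_univ a) (mem_univ b)
    linear_combination -this
  refine DifferentiableAt.congr_of_eventuallyEq ?_ key
  have hz' := Metric.mem_ball_self (x := z) hr
  refine (differentiableAt_const _).add (DifferentiableAt.sub ?_ ?_)
  · exact (((differentiableAt_const _).sub differentiableAt_id).div_const _).clog (hslit z hz' b)
  · exact (((differentiableAt_const _).sub differentiableAt_id).div_const _).clog (hslit z hz' a)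

/-! ### The Král bound and the angle subtended by a short segment -/

/-- Every continuous branch of the argument seen from a point of the curve has variation at most
`M`. -/
def ArgVariationBound (γ : ℝ → ℂ) (M : ℝ) : Prop :=
  ∀ s l, IsLogBranch (fun t => γ t - γ s) (Ioo s (s + 1)) l →
    eVariationOn (fun t => (l t).im) (Ioo s (s + 1)) ≤ ENNReal.ofReal M

theorem KralCondition.exists_argVariationBound {γ : ℝ → ℂ} (hγ : IsRectifiableJordanCurve γ)
    (hK : KralCondition γ) : ∃ M, 0 ≤ M ∧ ArgVariationBound γ M := by
  refine ⟨(⨆ s : ℝ, argVariation γ s).toReal, ENNReal.toReal_nonneg, fun s l hl => ?_⟩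
  rw [ENNReal.ofReal_toReal hK.ne]
  have hb : IsArgBranch γ s (fun t => (l t).im) := by
    refine ⟨Complex.continuous_im.comp_continuousOn hl.continuousOn, fun t ht => ?_⟩
    rw [← hl.exp_eq t ht, Complex.norm_exp, Complex.ofReal_exp, ← Complex.exp_add,
      Complex.re_add_im]
  rw [← hb.argVariation_eq hγ]
  exact le_iSup (fun s => argVariation γ s) s

/-- The angle at which the segment from `z` to `w` is seen from `p`. -/
noncomputable def angleAbs (z w p : ℂ) : ℝ :=
  |Complex.arg (1 - (w - z) / (p - z))|

theorem angleAbs_nonneg (z w p : ℂ) : 0 ≤ angleAbs z w p := abs_nonneg _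

theorem angleAbs_le {z w p : ℂ} (h : ‖w - z‖ ≤ ‖p - z‖) : angleAbs z w p ≤ Real.pi / 2 := by
  rw [angleAbs, Complex.abs_arg_le_pi_div_two_iff, Complex.sub_re, Complex.one_re, sub_nonneg]
  refine (Complex.re_le_norm _).trans ?_
  rw [norm_div]
  exact div_le_one_of_le₀ h (norm_nonneg _)

theorem exists_angleAbs_lt {ε : ℝ} (hε : 0 < ε) :
    ∃ ρ > 0, ∀ z w p : ℂ, ‖(w - z) / (p - z)‖ < ρ → angleAbs z w p < ε := by
  have h : ContinuousAt (fun v : ℂ => Complex.arg (1 - v)) 0 :=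
    (Complex.continuousAt_arg (by simp)).comp (by fun_prop)
  obtain ⟨ρ, hρ, H⟩ := Metric.continuousAt_iff.mp h ε hε
  refine ⟨ρ, hρ, fun z w p hv => ?_⟩
  simpa [angleAbs] using H (x := (w - z) / (p - z)) (by simpa using hv)

/-- The quotient is `1 - v` with `‖v‖ ≤ 1` and `v ≠ 1`, so its real part is positive. -/
theorem mem_slitPlane_of_norm_le {z w p : ℂ} (h : ‖w - z‖ ≤ ‖p - z‖) (hp : p ≠ w) (hpz : p ≠ z) :
    (p - w) / (p - z) ∈ Complex.slitPlane := by
  have h0 : p - z ≠ 0 := sub_ne_zero.mpr hpz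
  have h1 : (p - w) / (p - z) = 1 - (w - z) / (p - z) := by field_simp; ring
  have h2 : ‖(w - z) / (p - z)‖ ≤ 1 := by
    rw [norm_div]; exact div_le_one_of_le₀ h (norm_nonneg _)
  left
  rw [h1, Complex.sub_re, Complex.one_re, sub_pos]
  refine ((Complex.re_le_norm _).trans h2).lt_of_ne fun h3 => ?_
  set v := (w - z) / (p - z) with hv
  have h4 : v.im = 0 := by
    have := Complex.sq_norm v
    rw [Complex.normSq_apply] at this
    nlinarith [norm_nonneg v]
  have h5 : v = 1 := Complex.ext (by simpa using h3) (by simpa using h4)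
  rw [h5, sub_self, div_eq_zero_iff] at h1
  exact h1.elim (fun h => hp (sub_eq_zero.mp h)) h0

/-! ### Comparing a viewpoint off the curve with its nearest point on the curve -/

section nearest

variable {γ : ℝ → ℂ} {M : ℝ} {z : ℂ} {l : ℝ → ℂ} {s : ℝ}

theorem exists_branch_compare (hγ : IsRectifiableJordanCurve γ) (hz : z ∉ range γ)
    (hl : IsLogBranch (fun t => γ t - z) univ l) (hs : ∀ t, ‖γ s - z‖ ≤ ‖γ t - z‖) :
    ∃ a, IsLogBranch (fun t => γ t - γ s) (Ioo s (s + 1)) a ∧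
      ∀ x ∈ Ioo s (s + 1), ∀ y ∈ Ioo s (s + 1), |(l x).im - (l y).im| ≤
        |(a x).im - (a y).im| + angleAbs z (γ s) (γ x) + angleAbs z (γ s) (γ y) := by
  obtain ⟨a, ha⟩ := exists_isLogBranch (convex_Ioo s (s + 1)) isOpen_Ioo
    ⟨s + 1 / 2, by constructor <;> linarith⟩
    (g := fun t => γ t - γ s) (hγ.continuous.sub continuous_const).continuousOn
    (fun t ht => sub_ne_zero.mpr (hγ.apply_ne ht))
  refine ⟨a, ha, fun x hx y hy => ?_⟩
  have hne : ∀ t, γ t ≠ z := fun t h => hz ⟨t, h⟩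
  have := ha.abs_im_sub_le (hl.mono (subset_univ _)) isPreconnected_Ioo
    (fun t ht => mem_slitPlane_of_norm_le (hs t) (hγ.apply_ne ht) (hne t)) hx hy
  have e : ∀ t, (γ t - γ s) / (γ t - z) = 1 - (γ s - z) / (γ t - z) := fun t => by
    have := sub_ne_zero.mpr (hne t)
    field_simp; ring
  rwa [e, e] at this

theorem abs_im_sub_le_of_mem_Ioo (hγ : IsRectifiableJordanCurve γ) (hM0 : 0 ≤ M)
    (hM : ArgVariationBound γ M) (hz : z ∉ range γ)
    (hl : IsLogBranch (fun t => γ t - z) univ l) (hs : ∀ t, ‖γ s - z‖ ≤ ‖γ t - z‖) {x y : ℝ}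
    (hx : x ∈ Ioo s (s + 1)) (hy : y ∈ Ioo s (s + 1)) :
    |(l x).im - (l y).im| ≤ M + Real.pi := by
  obtain ⟨a, ha, h⟩ := exists_branch_compare hγ hz hl hs
  have h1 := (eVariationOn.edist_le (fun t => (a t).im) hx hy).trans (hM s a ha)
  rw [edist_dist, ENNReal.ofReal_le_ofReal_iff hM0, Real.dist_eq] at h1
  linarith [h x hx y hy, angleAbs_le (hs x), angleAbs_le (hs y)]

/-- Seen from `z` off the curve, the argument stays continuous at the parameters `s` and `s + 1`, so
the bound passes to the closed interval. -/
theorem abs_im_sub_le_of_mem_Icc (hγ : IsRectifiableJordanCurve γ) (hM0 : 0 ≤ M)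
    (hM : ArgVariationBound γ M) (hz : z ∉ range γ)
    (hl : IsLogBranch (fun t => γ t - z) univ l) (hs : ∀ t, ‖γ s - z‖ ≤ ‖γ t - z‖) {x y : ℝ}
    (hx : x ∈ Icc s (s + 1)) (hy : y ∈ Icc s (s + 1)) :
    |(l x).im - (l y).im| ≤ M + Real.pi := by
  have hlc : Continuous l := continuousOn_univ.mp hl.continuousOn
  have hcl : IsClosed {p : ℝ × ℝ | |(l p.1).im - (l p.2).im| ≤ M + Real.pi} :=
    isClosed_le (by fun_prop) continuous_const
  have hsub : Ioo s (s + 1) ×ˢ Ioo s (s + 1) ⊆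
      {p : ℝ × ℝ | |(l p.1).im - (l p.2).im| ≤ M + Real.pi} :=
    fun p hp => abs_im_sub_le_of_mem_Ioo hγ hM0 hM hz hl hs hp.1 hp.2
  have := closure_minimal hsub hcl
  rw [closure_prod_eq, closure_Ioo (by linarith)] at this
  exact this (mk_mem_prod hx hy)

/-- The variation seen from `γ s` is paid once, as `M`; only the subtended angles accumulate over
the partition points. -/
theorem sum_abs_im_sub_le (hγ : IsRectifiableJordanCurve γ) (hM0 : 0 ≤ M)
    (hM : ArgVariationBound γ M) (hz : z ∉ range γ)
    (hl : IsLogBranch (fun t => γ t - z) univ l) (hs : ∀ t, ‖γ s - z‖ ≤ ‖γ t - z‖)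
    {m n : ℕ} {u : ℕ → ℝ} (hu : Monotone u) (us : ∀ i ∈ Icc m n, u i ∈ Ioo s (s + 1)) :
    ∑ i ∈ Finset.Ico m n, |(l (u (i + 1))).im - (l (u i)).im| ≤
      M + ∑ i ∈ Finset.Ico m n,
        (angleAbs z (γ s) (γ (u (i + 1))) + angleAbs z (γ s) (γ (u i))) := by
  obtain ⟨a, ha, h⟩ := exists_branch_compare hγ hz hl hs
  have h1 := (eVariationOn.sum_le_of_monotoneOn_Icc (f := fun t => (a t).im)
    (hu.monotoneOn _) us).trans (hM s a ha)
  simp only [edist_dist] at h1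
  rw [← ENNReal.ofReal_sum_of_nonneg (fun _ _ => dist_nonneg),
    ENNReal.ofReal_le_ofReal_iff hM0] at h1
  refine le_trans ?_ (add_le_add_left h1 _)
  rw [← Finset.sum_add_distrib]
  refine Finset.sum_le_sum fun i hi => ?_
  rw [Finset.mem_Ico] at hi
  have := h _ (us (i + 1) ⟨by omega, by omega⟩) _ (us i ⟨by omega, by omega⟩)
  rw [Real.dist_eq]
  linarith

end nearest

/-! ### Uniform partitions seen from near the curve and from far away -/

theorem sum_le_of_subsingleton_exceptions {ι : Type*} [DecidableEq ι] (S : Finset ι) (f : ι → ℝ)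
    {a ε : ℝ} (ha : 0 ≤ a) (hε : 0 ≤ ε) (hf : ∀ i ∈ S, f i ≤ a) (bad : ι → Prop)
    (hgood : ∀ i ∈ S, ¬ bad i → f i ≤ ε) (hbad : ∀ i ∈ S, ∀ j ∈ S, bad i → bad j → i = j) :
    ∑ i ∈ S, f i ≤ a + S.card * ε := by
  by_cases h : ∃ i ∈ S, bad i
  · obtain ⟨i, hi, hb⟩ := h
    rw [← Finset.add_sum_erase S f hi]
    refine add_le_add (hf i hi) ?_
    have h1 : ∑ j ∈ S.erase i, f j ≤ (S.erase i).card • ε := by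
      refine Finset.sum_le_card_nsmul _ _ _ fun j hj => ?_
      rw [Finset.mem_erase] at hj
      exact hgood j hj.2 fun hbj => hj.1 (hbad j hj.2 i hi hbj hb)
    rw [nsmul_eq_mul] at h1
    refine h1.trans (mul_le_mul_of_nonneg_right ?_ hε)
    exact_mod_cast Finset.card_erase_le
  · push Not at h
    have h1 : ∑ j ∈ S, f j ≤ S.card • ε :=
      Finset.sum_le_card_nsmul _ _ _ fun j hj => hgood j hj (h j hj)
    rw [nsmul_eq_mul] at h1
    linarith

theorem IsRectifiableJordanCurve.image_Icc {γ : ℝ → ℂ} (hγ : IsRectifiableJordanCurve γ) :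
    γ '' Icc 0 1 = range γ := by
  simpa using hγ.periodic.image_Icc one_pos 0

theorem IsRectifiableJordanCurve.isCompact_range {γ : ℝ → ℂ} (hγ : IsRectifiableJordanCurve γ) :
    IsCompact (range γ) := by
  rw [← hγ.image_Icc]
  exact isCompact_Icc.image hγ.continuous

section uniform

variable {γ : ℝ → ℂ} {M : ℝ}

theorem exists_separation (hγ : IsRectifiableJordanCurve γ) (N : ℕ) :
    ∃ c > 0, ∀ i < N, ∀ j < N, i ≠ j → c ≤ dist (γ (i / N)) (γ (j / N)) := by
  classical
  set P := ((Finset.range N ×ˢ Finset.range N).filter fun p => p.1 ≠ p.2) with hP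
  rcases P.eq_empty_or_nonempty with h | h
  · refine ⟨1, one_pos, fun i hi j hj hij => ?_⟩
    have : (i, j) ∈ P := by simp [hP, hi, hj, hij]
    simp [h] at this
  · obtain ⟨p, hp, hmin⟩ := P.exists_min_image
      (fun p => dist (γ ((p.1 : ℕ) / N)) (γ ((p.2 : ℕ) / N))) h
    refine ⟨_, ?_, fun i hi j hj hij => hmin (i, j) (by simp [hP, hi, hj, hij])⟩
    simp only [hP, Finset.mem_filter, Finset.mem_product, Finset.mem_range] at hp
    have hN : (0 : ℝ) < N := by exact_mod_cast (by omega : 0 < N)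
    rw [gt_iff_lt, dist_pos]
    intro heq
    have hmem : ∀ i < N, (i / N : ℝ) ∈ Ico (0 : ℝ) 1 := fun i hi =>
      ⟨by positivity, by rw [div_lt_one hN]; exact_mod_cast hi⟩
    have := hγ.injOn (hmem _ hp.1.1) (hmem _ hp.1.2) heq
    rw [div_left_inj' hN.ne'] at this
    exact hp.2 (by exact_mod_cast this)

/-- Distinct partition points are at least `c` apart, so at most one lies within `c / 2` of `w`; it
costs `π / 2`, and the others cost at most `1 / (N + 1)` each. The nodes `0` and `N` are the same
point of the curve, hence a second `π / 2`. -/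
theorem exists_sum_angleAbs_le (hγ : IsRectifiableJordanCurve γ) (N : ℕ) :
    ∃ δ > 0, ∀ z w : ℂ, (∀ t, ‖w - z‖ ≤ ‖γ t - z‖) → ‖w - z‖ ≤ δ →
      ∑ i ∈ Finset.range (N + 1), angleAbs z w (γ (i / N)) ≤ Real.pi + 1 := by
  obtain ⟨c, hc, hsep⟩ := exists_separation hγ N
  have hε : (0 : ℝ) < 1 / (N + 1) := by positivity
  obtain ⟨ρ, hρ, hang⟩ := exists_angleAbs_lt hε
  -- The bound `c / 4` keeps `z` at distance at least `c / 4` from a point `c / 2` away from `w`;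
  -- then `ρ * c / 8` makes the ratio at most `ρ / 2`.
  refine ⟨min (c / 4) (ρ * c / 8), by positivity, fun z w hw hδ => ?_⟩
  have hgood : ∀ p : ℂ, c / 2 ≤ dist p w → angleAbs z w p ≤ 1 / (N + 1) := by
    intro p hp
    refine (hang z w p ?_).le
    have h1 : ‖w - z‖ ≤ c / 4 := hδ.trans (min_le_left _ _)
    have h2 : ‖w - z‖ ≤ ρ * c / 8 := hδ.trans (min_le_right _ _)
    have h3 : c / 4 ≤ ‖p - z‖ := by
      rw [dist_eq_norm] at hp
      have : ‖p - w‖ ≤ ‖p - z‖ + ‖w - z‖ := by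
        simpa using norm_sub_le (p - z) (w - z)
      linarith
    rw [norm_div, div_lt_iff₀ (by linarith)]
    nlinarith
  rw [Finset.sum_range_succ]
  have hsum := sum_le_of_subsingleton_exceptions (Finset.range N)
    (fun i => angleAbs z w (γ ((i : ℕ) / N))) (a := Real.pi / 2) (by positivity) hε.le
    (fun i _ => angleAbs_le (hw _)) (fun i => dist (γ ((i : ℕ) / N)) w < c / 2)
    (fun i _ hi => hgood _ (not_lt.mp hi))
    (fun i hi j hj hbi hbj => by
      by_contra hij
      have := hsep i (Finset.mem_range.mp hi) j (Finset.mem_range.mp hj) hij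
      linarith [dist_triangle_right (γ ((i : ℕ) / N)) (γ ((j : ℕ) / N)) w])
  have hlast : angleAbs z w (γ ((N : ℕ) / N)) ≤ Real.pi / 2 := angleAbs_le (hw _)
  have : ((Finset.range N).card : ℝ) * (1 / (N + 1)) ≤ 1 := by
    rw [Finset.card_range, mul_one_div, div_le_one (by positivity)]
    linarith
  linarith

/-- The nearest point `γ τ` splits the partition: nodes after `τ` are compared on `(τ, τ + 1)`,
nodes before it on `(τ - 1, τ)`. Cells touching an endpoint of these intervals use the oscillation
bound `M + π`. -/
theorem exists_sum_le_of_near (hγ : IsRectifiableJordanCurve γ) (hM0 : 0 ≤ M)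
    (hM : ArgVariationBound γ M) {N : ℕ} (hN : 0 < N) :
    ∃ δ > 0, ∀ z ∉ range γ, Metric.infDist z (range γ) ≤ δ →
      ∀ l, IsLogBranch (fun t => γ t - z) univ l →
        ∑ i ∈ Finset.range N, |(l ((i + 1 : ℕ) / N)).im - (l (i / N)).im| ≤
          6 * M + 8 * Real.pi + 4 := by
  obtain ⟨δ, hδ, hang⟩ := exists_sum_angleAbs_le hγ N
  refine ⟨δ, hδ, fun z hz hzδ l hl => ?_⟩
  have hcpt := hγ.isCompact_range
  obtain ⟨_, ⟨t, rfl⟩, hdist⟩ := hcpt.exists_infDist_eq_dist (range_nonempty γ) z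
  obtain ⟨τ, hτ, hτt⟩ := hγ.periodic.exists_mem_Ico₀ one_pos t
  rw [hτt] at hdist
  have hnear : ∀ t, ‖γ τ - z‖ ≤ ‖γ t - z‖ := fun t => by
    rw [← dist_eq_norm, ← dist_eq_norm, dist_comm, dist_comm _ z, ← hdist]
    exact Metric.infDist_le_dist_of_mem ⟨t, rfl⟩
  have hshift : γ (τ - 1) = γ τ := hγ.periodic.sub_eq τ
  have hnear' : ∀ t, ‖γ (τ - 1) - z‖ ≤ ‖γ t - z‖ := by rwa [hshift]
  have hang' := hang z (γ τ) hnear (by rwa [← dist_eq_norm, dist_comm, ← hdist])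
  set u : ℕ → ℝ := fun i => i / N with hu_def
  set A : ℕ → ℝ := fun i => angleAbs z (γ τ) (γ (u i)) with hA
  set d : ℕ → ℝ := fun i => |(l (u (i + 1))).im - (l (u i)).im| with hd
  have hNpos : (0 : ℝ) < N := by exact_mod_cast hN
  have hu : Monotone u := fun i j hij => by
    simp only [hu_def]; gcongr
  have hu0 : ∀ i, 0 ≤ u i := fun i => by positivity
  have hu1 : ∀ i ≤ N, u i ≤ 1 := fun i hi => by
    simp only [hu_def]; rw [div_le_one hNpos]; exact_mod_cast hi
  have hu1' : ∀ i < N, u i < 1 := fun i hi => by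
    simp only [hu_def]; rw [div_lt_one hNpos]; exact_mod_cast hi
  have hAsum : ∀ m n, n ≤ N → ∑ i ∈ Finset.Ico m n, (A (i + 1) + A i) ≤ 2 * (Real.pi + 1) := by
    intro m n hn
    have hA0 : ∀ i, 0 ≤ A i := fun i => angleAbs_nonneg _ _ _
    have h1 : ∑ i ∈ Finset.Ico m n, (A (i + 1) + A i) ≤
        ∑ i ∈ Finset.range N, (A (i + 1) + A i) := by
      refine Finset.sum_le_sum_of_subset_of_nonneg (fun i hi => ?_)
        fun i _ _ => add_nonneg (hA0 _) (hA0 _)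
      rw [Finset.mem_Ico] at hi
      exact Finset.mem_range.mpr (by omega)
    simp only [Finset.sum_add_distrib] at h1 ⊢
    have h2 := Finset.sum_range_succ A N
    have h3 := Finset.sum_range_succ' A N
    have : ∑ i ∈ Finset.range (N + 1), A i ≤ Real.pi + 1 := hang'
    linarith [hA0 0, hA0 N]
  set k := ⌊τ * N⌋₊ with hk
  have hτN : 0 ≤ τ * N := mul_nonneg hτ.1 hNpos.le
  have hk1 : u k ≤ τ := by
    simp only [hu_def]; rw [div_le_iff₀ hNpos]; exact Nat.floor_le hτN
  have hk2 : τ < u (k + 1) := by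
    simp only [hu_def]; rw [lt_div_iff₀ hNpos]; exact_mod_cast Nat.lt_floor_add_one _
  have hkN : k < N := by
    rw [hk, Nat.floor_lt hτN]; nlinarith [hτ.2]
  have hcl : ∀ x ∈ Icc τ (τ + 1), ∀ y ∈ Icc τ (τ + 1), |(l x).im - (l y).im| ≤ M + Real.pi :=
    fun x hx y hy => abs_im_sub_le_of_mem_Icc hγ hM0 hM hz hl hnear hx hy
  have hcl' : ∀ x ∈ Icc (τ - 1) τ, ∀ y ∈ Icc (τ - 1) τ, |(l x).im - (l y).im| ≤ M + Real.pi :=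
    fun x hx y hy => abs_im_sub_le_of_mem_Icc hγ hM0 hM hz hl hnear'
      (by simpa using hx) (by simpa using hy)
  have hleft : ∑ i ∈ Finset.Ico 0 k, d i ≤ M + 2 * (Real.pi + 1) + (M + Real.pi) := by
    rcases Nat.eq_zero_or_pos k with h0 | h0
    · rw [h0, Finset.Ico_self, Finset.sum_empty]; positivity
    · obtain ⟨j, hj⟩ : ∃ j, k = j + 1 := ⟨k - 1, by omega⟩
      have huj : u j < τ := by
        refine lt_of_lt_of_le ?_ hk1
        simp only [hu_def]; gcongr; omega
      -- The last cell is split off because `u k` may equal `τ`, which the open interval excludes.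
      rw [hj, Finset.sum_Ico_succ_top (Nat.zero_le j)]
      refine add_le_add ?_ ?_
      · refine (sum_abs_im_sub_le hγ hM0 hM hz hl hnear' hu (m := 0) (n := j)
          fun i hi => ⟨by linarith [hu0 i, hτ.2], ?_⟩).trans ?_
        · rw [sub_add_cancel]; exact (hu hi.2).trans_lt huj
        · rw [hshift]; exact add_le_add_right (hAsum 0 j (by omega)) M
      · rw [hj] at hk1
        exact hcl' _ ⟨by linarith [hu0 (j + 1), hτ.2], hk1⟩ _
          ⟨by linarith [hu0 j, hτ.2], huj.le⟩
  -- This cell contains `τ`; passing through `τ` uses one closed interval on each side.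
  have hmid : d k ≤ (M + Real.pi) + (M + Real.pi) := by
    refine (abs_sub_le _ (l τ).im _).trans (add_le_add ?_ ?_)
    · exact hcl _ ⟨hk2.le, by linarith [hu1 (k + 1) hkN, hτ.1]⟩ _ ⟨le_rfl, by linarith⟩
    · exact hcl' _ ⟨by linarith, le_rfl⟩ _ ⟨by linarith [hu0 k, hτ.2], hk1⟩
  have hright : ∑ i ∈ Finset.Ico (k + 1) N, d i ≤ M + 2 * (Real.pi + 1) + (M + Real.pi) := by
    rcases (show k + 1 ≤ N from hkN).eq_or_lt with h0 | h0
    · rw [h0, Finset.Ico_self, Finset.sum_empty]; positivity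
    -- The cell ending at `1` is split off: for `τ = 0` its endpoint is `τ + 1`.
    · obtain ⟨n, hn⟩ : ∃ n, N = n + 1 := ⟨N - 1, by omega⟩
      have hsplit : ∑ i ∈ Finset.Ico (k + 1) N, d i =
          ∑ i ∈ Finset.Ico (k + 1) n, d i + d n := by
        rw [show Finset.Ico (k + 1) N = Finset.Ico (k + 1) (n + 1) by rw [hn],
          Finset.sum_Ico_succ_top (by omega)]
      have hgt : ∀ i, k + 1 ≤ i → τ < u i := fun i hi => hk2.trans_le (hu hi)
      rw [hsplit]
      refine add_le_add ?_ ?_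
      · refine (sum_abs_im_sub_le hγ hM0 hM hz hl hnear hu
          fun i hi => ⟨hgt i hi.1, ?_⟩).trans ?_
        · linarith [hu1' i (by have := hi.2; omega), hτ.1]
        · exact add_le_add_right (hAsum (k + 1) n (by omega)) M
      · exact hcl _ ⟨(hgt _ (by omega)).le, by linarith [hu1 (n + 1) hn.ge, hτ.1]⟩ _
          ⟨(hgt _ (by omega)).le, by linarith [hu1 n (by omega), hτ.1]⟩
  have htotal : ∑ i ∈ Finset.range N, d i =
      ∑ i ∈ Finset.Ico 0 k, d i + d k + ∑ i ∈ Finset.Ico (k + 1) N, d i := by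
    rw [← Finset.sum_Ico_succ_top (Nat.zero_le k),
      Finset.sum_Ico_consecutive _ (Nat.zero_le _) hkN, Finset.range_eq_Ico]
  change ∑ i ∈ Finset.range N, d i ≤ _
  rw [htotal]
  linarith

/-- From far away every `γ t - z` points almost in the direction `-z`, so a constant branch serves
for comparison. -/
theorem exists_sum_le_of_far (hγ : IsRectifiableJordanCurve γ) (N : ℕ) :
    ∃ R, ∀ z : ℂ, R ≤ ‖z‖ → ∀ l, IsLogBranch (fun t => γ t - z) univ l →
        ∑ i ∈ Finset.range N, |(l ((i + 1 : ℕ) / N)).im - (l (i / N)).im| ≤ 2 := by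
  obtain ⟨B, hB0, hB⟩ := hγ.isCompact_range.isBounded.exists_pos_norm_le
  have hε : (0 : ℝ) < 1 / (N + 1) := by positivity
  obtain ⟨ρ, hρ, hang⟩ := exists_angleAbs_lt hε
  refine ⟨B + 2 * B + 2 * B / ρ, fun z hz l hl => ?_⟩
  have hBt : ∀ t, ‖γ t‖ ≤ B := fun t => hB _ ⟨t, rfl⟩
  have hρB : 0 < 2 * B / ρ := by positivity
  have hlow : ∀ t, 2 * B + 2 * B / ρ ≤ ‖γ t - z‖ := fun t => by
    have := norm_sub_norm_le z (γ t)
    rw [norm_sub_rev] at this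
    linarith [hBt t]
  have hz0 : z ≠ 0 := norm_pos_iff.mp (by linarith)
  have hform : ∀ t, (0 - z) / (γ t - z) = 1 - (z + γ t - z) / (γ t - z) := fun t => by
    have : γ t - z ≠ 0 := norm_pos_iff.mp (by linarith [hlow t])
    field_simp; ring
  have hsmall : ∀ t, |Complex.arg ((0 - z) / (γ t - z))| ≤ 1 / (N + 1) := fun t => by
    rw [hform]
    refine (hang z (z + γ t) (γ t) ?_).le
    rw [add_sub_cancel_left, norm_div, div_lt_iff₀ (by linarith [hlow t])]
    have h1 : ρ * (2 * B / ρ) = 2 * B := by field_simp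
    nlinarith [hlow t, hBt t]
  have hslit : ∀ t ∈ (univ : Set ℝ), (0 - z) / (γ t - z) ∈ Complex.slitPlane := fun t _ => by
    rw [hform, sub_eq_add_neg]
    apply Complex.mem_slitPlane_of_norm_lt_one
    rw [norm_neg, add_sub_cancel_left, norm_div, div_lt_one (by linarith [hlow t])]
    linarith [hlow t, hBt t]
  have hconst : IsLogBranch (fun _ => 0 - z) univ (fun _ => Complex.log (0 - z)) :=
    ⟨continuousOn_const, fun _ _ => Complex.exp_log (by simpa using hz0)⟩
  have hterm : ∀ i ∈ Finset.range N,
      |(l ((i + 1 : ℕ) / N)).im - (l (i / N)).im| ≤ 2 * (1 / (N + 1)) := fun i _ => by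
    have := hconst.abs_im_sub_le hl isPreconnected_univ hslit
      (mem_univ (((i + 1 : ℕ) : ℝ) / N)) (mem_univ ((i : ℝ) / N))
    rw [sub_self, abs_zero, zero_add] at this
    linarith [hsmall (((i + 1 : ℕ) : ℝ) / N), hsmall ((i : ℝ) / N)]
  refine (Finset.sum_le_card_nsmul _ _ _ hterm).trans ?_
  rw [Finset.card_range, nsmul_eq_mul]
  have : (N : ℝ) * (1 / (N + 1)) ≤ 1 := by
    rw [mul_one_div, div_le_one (by positivity)]
    linarith
  linarith

end uniform

/-! ### All viewpoints off the curve, by the maximum principle -/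

section offCurve

variable {γ : ℝ → ℂ} {M : ℝ}

/-- The bound for arguments seen from points near the curve extends to all points off the curve, by
the maximum modulus principle. -/
theorem sum_abs_im_sub_le_of_notMem (hγ : IsRectifiableJordanCurve γ) (hM0 : 0 ≤ M)
    (hM : ArgVariationBound γ M) {N : ℕ} (hN : 0 < N) {z : ℂ} (hz : z ∉ range γ) {l : ℝ → ℂ}
    (hl : IsLogBranch (fun t => γ t - z) univ l) :
    ∑ i ∈ Finset.range N, |(l ((i + 1 : ℕ) / N)).im - (l (i / N)).im| ≤
      6 * M + 8 * Real.pi + 4 := by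
  classical
  obtain ⟨δ, hδ, hnear⟩ := exists_sum_le_of_near hγ hM0 hM hN
  obtain ⟨R, hfar⟩ := exists_sum_le_of_far hγ N
  have hclosed : IsClosed (range γ) := hγ.isCompact_range.isClosed
  have hex : ∀ w, w ∉ range γ → ∃ l, IsLogBranch (fun t => γ t - w) univ l := fun w hw =>
    exists_isLogBranch convex_univ isOpen_univ univ_nonempty
      (hγ.continuous.sub continuous_const).continuousOn
      fun t _ => sub_ne_zero.mpr fun h => hw ⟨t, h⟩
  choose! L₀ hL₀ using hex
  -- The branch at `z` is the given one, so the bound at `z` concerns `l` itself.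
  set L := Function.update L₀ z l with hL_def
  have hLz : L z = l := Function.update_self ..
  have hL : ∀ w ∉ range γ, IsLogBranch (fun t => γ t - w) univ (L w) := fun w hw => by
    by_cases h : w = z
    · rw [h, hLz]; exact hl
    · rw [hL_def, Function.update_of_ne h]; exact hL₀ w hw
  -- The signs are frozen at the given `z`: the signed sum equals the absolute sum at `z` and is at
  -- most the absolute sum elsewhere.
  set σ : ℕ → ℝ := fun i => SignType.sign ((l ((i + 1 : ℕ) / N)).im - (l (i / N)).im) with hσ
  have hσ1 : ∀ i, |σ i| ≤ 1 := fun i => by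
    simp only [hσ]
    generalize SignType.sign ((l ((i + 1 : ℕ) / N)).im - (l (i / N)).im) = x
    cases x <;> norm_num
  set F : ℂ → ℂ := fun w => ∑ i ∈ Finset.range N,
    (σ i : ℂ) * (L w ((i + 1 : ℕ) / N) - L w (i / N)) with hF
  have hFim : ∀ w, (F w).im = ∑ i ∈ Finset.range N,
      σ i * ((L w ((i + 1 : ℕ) / N)).im - (L w (i / N)).im) := fun w => by
    simp [hF, Complex.im_sum]
  have hnorm : ∀ w, ‖Complex.exp (-Complex.I * F w)‖ = Real.exp (F w).im := fun w => by
    rw [Complex.norm_exp]; simp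
  have hbound : ∀ w, (F w).im ≤ ∑ i ∈ Finset.range N,
      |(L w ((i + 1 : ℕ) / N)).im - (L w (i / N)).im| := fun w => by
    rw [hFim]
    refine Finset.sum_le_sum fun i _ => (le_abs_self _).trans ?_
    rw [abs_mul]
    exact mul_le_of_le_one_left (abs_nonneg _) (hσ1 i)
  have hFz : (F z).im = ∑ i ∈ Finset.range N, |(l ((i + 1 : ℕ) / N)).im - (l (i / N)).im| := by
    rw [hFim, hLz]
    exact Finset.sum_congr rfl fun i _ => sign_mul_self _
  have hdiff : ∀ w ∉ range γ, DifferentiableAt ℂ (fun w => Complex.exp (-Complex.I * F w)) w := by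
    intro w hw
    refine (DifferentiableAt.const_mul ?_ _).cexp
    exact DifferentiableAt.fun_sum fun i _ =>
      (differentiableAt_logBranch_sub hclosed hL hw _ _).const_mul _
  have hd0 : 0 < Metric.infDist z (range γ) :=
    (hclosed.notMem_iff_infDist_pos (range_nonempty γ)).mp hz
  -- Halving the distance keeps `z` inside `V`, while `δ' ≤ δ` makes the near bound available on the
  -- inner frontier.
  set δ' := min δ (Metric.infDist z (range γ) / 2) with hδ'
  have hδ'0 : 0 < δ' := lt_min hδ (by linarith)
  set V : Set ℂ := {w | δ' < Metric.infDist w (range γ)} with hV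
  set U : Set ℂ := V ∩ Metric.ball 0 (max R (‖z‖ + 1)) with hU
  have hclV : closure V ⊆ {w | δ' ≤ Metric.infDist w (range γ)} :=
    closure_lt_subset_le continuous_const (Metric.continuous_infDist_pt _)
  have hclU : ∀ w ∈ closure U, w ∉ range γ := fun w hw h => by
    have h1 : δ' ≤ Metric.infDist w (range γ) := hclV (closure_mono inter_subset_left hw)
    rw [Metric.infDist_zero_of_mem h] at h1
    linarith
  have hzU : z ∈ U := by
    refine ⟨?_, ?_⟩
    · exact (min_le_right _ _).trans_lt (half_lt_self hd0)
    · rw [mem_ball_zero_iff]; exact (lt_add_one _).trans_le (le_max_right _ _)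
  have hmax : ‖Complex.exp (-Complex.I * F z)‖ ≤ Real.exp (6 * M + 8 * Real.pi + 4) := by
    refine Complex.norm_le_of_forall_mem_frontier_norm_le
      (f := fun w => Complex.exp (-Complex.I * F w))
      (Metric.isBounded_ball.subset inter_subset_right)
      (DifferentiableOn.diffContOnCl fun w hw => (hdiff w (hclU w hw)).differentiableWithinAt)
      (fun w hw => ?_) (subset_closure hzU)
    have hwγ := hclU w (frontier_subset_closure hw)
    rw [hnorm, Real.exp_le_exp]
    refine (hbound w).trans ?_
    rcases frontier_inter_subset _ _ hw with h | h
    · have h1 : δ' = Metric.infDist w (range γ) :=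
        frontier_lt_subset_eq continuous_const (Metric.continuous_infDist_pt _) h.1
      exact hnear w hwγ (h1.symm.le.trans (min_le_left _ _)) _ (hL w hwγ)
    · have h1 := Metric.frontier_ball_subset_sphere h.2
      rw [mem_sphere_zero_iff_norm] at h1
      refine (hfar w (h1 ▸ le_max_left _ _) _ (hL w hwγ)).trans ?_
      linarith [Real.pi_pos]
  rwa [hnorm, Real.exp_le_exp, hFz] at hmax

/-- The variation of a continuous function on `[0, 1]` is controlled by uniform partitions. -/
theorem eVariationOn_Icc_le_of_uniform {f : ℝ → ℝ} (hf : Continuous f) {K : ℝ}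
    (h : ∀ N : ℕ, 0 < N → ∑ i ∈ Finset.range N, |f ((i + 1 : ℕ) / N) - f (i / N)| ≤ K) :
    eVariationOn f (Icc 0 1) ≤ ENNReal.ofReal K := by
  -- The functions `x ↦ f (⌊x * N⌋₊ / N)` converge pointwise to `f`, and variation is lower
  -- semicontinuous; each has variation at most the partition sum.
  by_contra! hlt
  have htend : ∀ x ∈ Icc (0 : ℝ) 1,
      Tendsto (fun N : ℕ => f ((⌊x * N⌋₊ : ℝ) / N)) atTop (𝓝 (f x)) := fun x hx =>
    (hf.tendsto x).comp ((tendsto_nat_floor_mul_div_atTop hx.1).comp tendsto_natCast_atTop_atTop)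
  obtain ⟨N, hN, hN0⟩ := ((eVariationOn.lowerSemicontinuous_aux htend hlt).and
    (eventually_gt_atTop 0)).exists
  refine hN.not_ge ?_
  have hNpos : (0 : ℝ) < N := by exact_mod_cast hN0
  have hu : Monotone fun i : ℕ => (i / N : ℝ) := fun i j hij => by
    simp only; gcongr
  have h1 := eVariationOn.comp_le_of_monotoneOn f (t := Icc (0 : ℝ) 1)
    (s := (fun i : ℕ => (i / N : ℝ)) '' Iic N) (fun x => (⌊x * N⌋₊ : ℝ) / N)
    (fun x _ y _ hxy => hu (Nat.floor_mono (by gcongr)))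
    (fun x hx => ⟨⌊x * N⌋₊, Nat.floor_le_of_le (by nlinarith [hx.2]), rfl⟩)
  refine h1.trans ?_
  rw [eVariationOn.image_range_of_monotone f hu]
  simp only [edist_dist]
  rw [← ENNReal.ofReal_sum_of_nonneg (fun _ _ => dist_nonneg)]
  refine ENNReal.ofReal_le_ofReal ((Finset.sum_le_sum fun i _ => ?_).trans (h N hN0))
  rw [dist_comm, Real.dist_eq]

theorem eVariationOn_im_le_of_notMem (hγ : IsRectifiableJordanCurve γ) (hM0 : 0 ≤ M)
    (hM : ArgVariationBound γ M) {z : ℂ} (hz : z ∉ range γ) {l : ℝ → ℂ}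
    (hl : IsLogBranch (fun t => γ t - z) univ l) :
    eVariationOn (fun t => (l t).im) (Icc 0 1) ≤ ENNReal.ofReal (6 * M + 8 * Real.pi + 4) :=
  eVariationOn_Icc_le_of_uniform
    (Complex.continuous_im.comp (continuousOn_univ.mp hl.continuousOn))
    fun _ hN => sum_abs_im_sub_le_of_notMem hγ hM0 hM hN hz hl

end offCurve

/-! ### Arc length, and density of the complement -/

section arcLength

variable {γ : ℝ → ℂ}

theorem eVariationOn_Icc_eq_ofReal_arcCoord_sub (hγ : IsRectifiableJordanCurve γ) {a b : ℝ}
    (ha : 0 ≤ a) (hab : a ≤ b) (hb : b ≤ 1) :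
    eVariationOn γ (Icc a b) = ENNReal.ofReal (arcCoord γ b - arcCoord γ a) := by
  have hfin : ∀ t ≤ (1 : ℝ), eVariationOn γ (Icc 0 t) ≠ ⊤ := fun t ht =>
    ne_top_of_le_ne_top hγ.rectifiable (eVariationOn.mono γ (Icc_subset_Icc_right ht))
  have hadd := eVariationOn.Icc_add_Icc γ ha hab (mem_univ a)
  simp only [univ_inter] at hadd
  rw [arcCoord, arcCoord, ENNReal.ofReal_sub _ ENNReal.toReal_nonneg,
    ENNReal.ofReal_toReal (hfin b hb), ENNReal.ofReal_toReal (hfin a (hab.trans hb)), ← hadd,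
    ENNReal.add_sub_cancel_left (hfin a (hab.trans hb))]

theorem monotoneOn_arcCoord (hγ : IsRectifiableJordanCurve γ) :
    MonotoneOn (arcCoord γ) (Icc 0 1) := fun _ _ _ hb hab =>
  ENNReal.toReal_mono
    (ne_top_of_le_ne_top hγ.rectifiable (eVariationOn.mono γ (Icc_subset_Icc_right hb.2)))
    (eVariationOn.mono γ (Icc_subset_Icc_right hab))

theorem edist_le_edist_arcCoord (hγ : IsRectifiableJordanCurve γ) {a b : ℝ}
    (ha : a ∈ Icc (0 : ℝ) 1) (hb : b ∈ Icc (0 : ℝ) 1) :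
    edist (γ a) (γ b) ≤ edist (arcCoord γ a) (arcCoord γ b) := by
  wlog hab : a ≤ b generalizing a b
  · rw [edist_comm, edist_comm (arcCoord γ a)]
    exact this hb ha (le_of_not_ge hab)
  have h1 := eVariationOn.edist_le γ (left_mem_Icc.mpr hab) (right_mem_Icc.mpr hab)
  rw [eVariationOn_Icc_eq_ofReal_arcCoord_sub hγ ha.1 hab hb.2] at h1
  refine h1.trans ?_
  rw [edist_comm, edist_dist, Real.dist_eq]
  exact ENNReal.ofReal_le_ofReal (le_abs_self _)

/-- In the arc coordinate the curve is a 1-Lipschitz image of a subset of the line, so its Hausdorff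
dimension is at most 1. -/
theorem IsRectifiableJordanCurve.dense_compl_range (hγ : IsRectifiableJordanCurve γ) :
    Dense (range γ)ᶜ := by
  set S := arcCoord γ '' Icc 0 1 with hS
  set ψ := Function.invFunOn (arcCoord γ) (Icc 0 1) with hψ
  have hmem : ∀ x ∈ S, ψ x ∈ Icc (0 : ℝ) 1 := fun x hx => Function.invFunOn_mem hx
  have heq : ∀ x ∈ S, arcCoord γ (ψ x) = x := fun x hx => Function.invFunOn_eq hx
  have hlip : LipschitzOnWith 1 (γ ∘ ψ) S := fun x hx y hy => by
    have := edist_le_edist_arcCoord hγ (hmem x hx) (hmem y hy)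
    rw [heq x hx, heq y hy] at this
    simpa using this
  have himg : range γ ⊆ (γ ∘ ψ) '' S := by
    rw [← hγ.image_Icc]
    rintro _ ⟨t, ht, rfl⟩
    have htS : arcCoord γ t ∈ S := mem_image_of_mem _ ht
    refine ⟨arcCoord γ t, htS, ?_⟩
    have := edist_le_edist_arcCoord hγ (hmem _ htS) ht
    rw [heq _ htS, edist_self, nonpos_iff_eq_zero, edist_eq_zero] at this
    exact this
  apply dense_compl_of_dimH_lt_finrank
  calc dimH (range γ) ≤ dimH ((γ ∘ ψ) '' S) := dimH_mono himg
    _ ≤ dimH S := hlip.dimH_image_le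
    _ ≤ dimH (univ : Set ℝ) := dimH_mono (subset_univ _)
    _ = 1 := Real.dimH_univ
    _ < Module.finrank ℝ ℂ := by rw [Complex.finrank_real_complex]; norm_num

end arcLength

/-! ### Length in a small ball from two viewpoints -/

theorem abs_im_exp_mul_conj_exp_le (c d : ℂ) :
    |(Complex.exp d * (starRingEnd ℂ) (Complex.exp c)).im| ≤
      ‖Complex.exp d‖ * ‖Complex.exp c‖ * |d.im - c.im| := by
  rw [← Complex.exp_conj, ← Complex.exp_add, Complex.exp_im, abs_mul, Real.abs_exp,
    Complex.norm_exp, Complex.norm_exp, ← Real.exp_add]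
  simp only [Complex.add_re, Complex.conj_re, Complex.add_im, Complex.conj_im]
  exact mul_le_mul_of_nonneg_left Real.abs_sin_le_abs (Real.exp_pos _).le

/-- The arguments seen from two points in transversal directions control the distance. -/
theorem norm_sub_le_of_two_viewpoints {ξ z₁ z₂ p q c₁ d₁ c₂ d₂ : ℂ} {ε : ℝ} (hε : 0 < ε)
    (hp : ‖p - ξ‖ ≤ 2 * ε) (hq : ‖q - ξ‖ ≤ 2 * ε) (hz₁ : ‖z₁ - (ξ - (8 * ε : ℝ))‖ ≤ ε)
    (hz₂ : ‖z₂ - (ξ - (8 * ε : ℝ) * Complex.I)‖ ≤ ε)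
    (hc₁ : Complex.exp c₁ = p - z₁) (hd₁ : Complex.exp d₁ = q - z₁)
    (hc₂ : Complex.exp c₂ = p - z₂) (hd₂ : Complex.exp d₂ = q - z₂) :
    ‖q - p‖ ≤ 72 * ε * (|d₁.im - c₁.im| + |d₂.im - c₂.im|) := by
  have hnorm : ∀ (w v z : ℂ), ‖w - ξ‖ ≤ 2 * ε → ‖v‖ = 8 * ε → ‖z - (ξ - v)‖ ≤ ε →
      ‖w - z‖ ≤ 12 * ε := fun w v z h1 h2 h3 => by
    have : w - z = (w - ξ) + v - (z - (ξ - v)) := by ring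
    rw [this]
    linarith [norm_sub_le (w - ξ + v) (z - (ξ - v)), norm_add_le (w - ξ) v]
  have hv₁ : ‖((8 * ε : ℝ) : ℂ)‖ = 8 * ε := by
    rw [Complex.norm_real, Real.norm_of_nonneg (by positivity)]
  have hv₂ : ‖((8 * ε : ℝ) : ℂ) * Complex.I‖ = 8 * ε := by
    rw [norm_mul, hv₁, Complex.norm_I, mul_one]
  -- Distances to the viewpoints are at most `2ε + 8ε + ε ≤ 12ε`, and `12 ^ 2 = 144`.
  have h144 : ∀ a b x : ℝ, 0 ≤ a → a ≤ 12 * ε → 0 ≤ b → b ≤ 12 * ε →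
      a * b * |x| ≤ 144 * ε ^ 2 * |x| := fun a b x h1 h2 h3 h4 => by
    refine mul_le_mul_of_nonneg_right ?_ (abs_nonneg x)
    nlinarith [mul_le_mul h2 h4 h3 (by positivity)]
  have k₁ := abs_im_exp_mul_conj_exp_le c₁ d₁
  have k₂ := abs_im_exp_mul_conj_exp_le c₂ d₂
  rw [hc₁, hd₁] at k₁
  rw [hc₂, hd₂] at k₂
  replace k₁ := k₁.trans (h144 _ _ _ (norm_nonneg _) (hnorm q _ z₁ hq hv₁ hz₁) (norm_nonneg _)
    (hnorm p _ z₁ hp hv₁ hz₁))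
  replace k₂ := k₂.trans (h144 _ _ _ (norm_nonneg _) (hnorm q _ z₂ hq hv₂ hz₂) (norm_nonneg _)
    (hnorm p _ z₂ hp hv₂ hz₂))
  set X := q.re - p.re with hX
  set Y := q.im - p.im with hY
  have e₁ : ((q - z₁) * (starRingEnd ℂ) (p - z₁)).im = Y * (p - z₁).re - X * (p - z₁).im := by
    simp [hX, hY]; ring
  have e₂ : ((q - z₂) * (starRingEnd ℂ) (p - z₂)).im = Y * (p - z₂).re - X * (p - z₂).im := by
    simp [hX, hY]; ring
  rw [e₁] at k₁
  rw [e₂] at k₂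
  have hpr := abs_le.mp ((Complex.abs_re_le_norm _).trans hp)
  have hpi := abs_le.mp ((Complex.abs_im_le_norm _).trans hp)
  have hr₁ := abs_le.mp ((Complex.abs_re_le_norm _).trans hz₁)
  have hi₁ := abs_le.mp ((Complex.abs_im_le_norm _).trans hz₁)
  have hr₂ := abs_le.mp ((Complex.abs_re_le_norm _).trans hz₂)
  have hi₂ := abs_le.mp ((Complex.abs_im_le_norm _).trans hz₂)
  simp only [Complex.sub_re, Complex.sub_im, Complex.ofReal_re, Complex.ofReal_im, Complex.mul_re,
    Complex.mul_im, Complex.I_re, Complex.I_im] at hpr hpi hr₁ hi₁ hr₂ hi₂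
  -- Each cross product has a dominant coefficient of at least `8ε - 2ε - ε = 5ε` and another of at
  -- most `2ε + ε = 3ε`. Adding the two inequalities leaves the factor `2ε`, whence `144 / 2 = 72`.
  have main : ∀ a b s t E : ℝ, 5 * ε ≤ a → |b| ≤ 3 * ε → |s * a - t * b| ≤ E →
      5 * ε * |s| ≤ E + 3 * ε * |t| := fun a b s t E ha hb hE => by
    have h1 : |s * a| ≤ |s * a - t * b| + |t * b| := by
      simpa using abs_add_le (s * a - t * b) (t * b)
    rw [abs_mul, abs_mul, abs_of_nonneg (by linarith : 0 ≤ a)] at h1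
    nlinarith [abs_nonneg s, abs_nonneg t, mul_le_mul_of_nonneg_left ha (abs_nonneg s),
      mul_le_mul_of_nonneg_left hb (abs_nonneg t)]
  have m₁ := main (p - z₁).re (p - z₁).im Y X _ (by rw [Complex.sub_re]; linarith)
    (by rw [Complex.sub_im, abs_le]; constructor <;> linarith) k₁
  have m₂ := main (p - z₂).im (p - z₂).re X Y _ (by rw [Complex.sub_im]; linarith)
    (by rw [Complex.sub_re, abs_le]; constructor <;> linarith) ((abs_sub_comm _ _).trans_le k₂)
  have hXY : |X| + |Y| ≤ 72 * ε * (|d₁.im - c₁.im| + |d₂.im - c₂.im|) := by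
    refine le_of_mul_le_mul_left ?_ (show 0 < 2 * ε by positivity)
    linarith
  refine (Complex.norm_le_abs_re_add_abs_im _).trans ?_
  rwa [Complex.sub_re, Complex.sub_im]

theorem eVariationOn_le_const_mul_add {α E E₁ E₂ : Type*} [LinearOrder α] [PseudoEMetricSpace E]
    [PseudoEMetricSpace E₁] [PseudoEMetricSpace E₂] {f : α → E} {g₁ : α → E₁} {g₂ : α → E₂}
    {s : Set α} {C : ℝ≥0∞}
    (h : ∀ x ∈ s, ∀ y ∈ s,
      edist (f x) (f y) ≤ C * (edist (g₁ x) (g₁ y) + edist (g₂ x) (g₂ y))) :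
    eVariationOn f s ≤ C * (eVariationOn g₁ s + eVariationOn g₂ s) := by
  refine iSup_le fun ⟨n, u, hu, us⟩ => ?_
  refine (Finset.sum_le_sum fun i _ => h _ (us (i + 1)) _ (us i)).trans ?_
  rw [← Finset.mul_sum, Finset.sum_add_distrib]
  gcongr <;> exact eVariationOn.sum_le hu us

section ball

variable {γ : ℝ → ℂ} {M : ℝ}

theorem volume_arcCoord_image_Icc_le (hγ : IsRectifiableJordanCurve γ) {a b : ℝ} (ha : 0 ≤ a)
    (hab : a ≤ b) (hb : b ≤ 1) :
    volume (arcCoord γ '' Icc a b) ≤ eVariationOn γ (Icc a b) := by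
  rw [eVariationOn_Icc_eq_ofReal_arcCoord_sub hγ ha hab hb, ← Real.volume_Icc]
  refine measure_mono ?_
  rintro _ ⟨t, ht, rfl⟩
  have hm := monotoneOn_arcCoord hγ
  have ht' : t ∈ Icc (0 : ℝ) 1 := ⟨ha.trans ht.1, ht.2.trans hb⟩
  exact ⟨hm ⟨ha, hab.trans hb⟩ ht' ht.1, hm ht' ⟨ha.trans hab, hb⟩ ht.2⟩

theorem exists_viewpoint (hγ : IsRectifiableJordanCurve γ) (hM0 : 0 ≤ M)
    (hM : ArgVariationBound γ M) (p : ℂ) {ε : ℝ} (hε : 0 < ε) :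
    ∃ z l, ‖z - p‖ ≤ ε ∧ IsLogBranch (fun t => γ t - z) univ l ∧
      eVariationOn (fun t => (l t).im) (Icc 0 1) ≤ ENNReal.ofReal (6 * M + 8 * Real.pi + 4) := by
  obtain ⟨z, hz, hzp⟩ := hγ.dense_compl_range.exists_dist_lt p hε
  obtain ⟨l, hl⟩ := exists_isLogBranch convex_univ isOpen_univ univ_nonempty
    (g := fun t => γ t - z) (hγ.continuous.sub continuous_const).continuousOn
    fun t _ => sub_ne_zero.mpr fun h => hz ⟨t, h⟩
  refine ⟨z, l, ?_, hl, eVariationOn_im_le_of_notMem hγ hM0 hM hz hl⟩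
  rw [← dist_eq_norm, dist_comm]
  exact hzp.le

theorem arcMes_closedBall_le (hγ : IsRectifiableJordanCurve γ) (hM0 : 0 ≤ M)
    (hM : ArgVariationBound γ M) (ξ : ℂ) {ε : ℝ} (hε : 0 < ε) :
    arcMes γ {p | ‖p - ξ‖ ≤ ε} ≤
      ENNReal.ofReal (72 * ε) * (2 * ENNReal.ofReal (6 * M + 8 * Real.pi + 4)) := by
  classical
  obtain ⟨z₁, l₁, hz₁, hl₁, hv₁⟩ := exists_viewpoint hγ hM0 hM (ξ - (8 * ε : ℝ)) hε
  obtain ⟨z₂, l₂, hz₂, hl₂, hv₂⟩ :=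
    exists_viewpoint hγ hM0 hM (ξ - (8 * ε : ℝ) * Complex.I) hε
  obtain ⟨δ, hδ, huc⟩ := Metric.uniformContinuousOn_iff.mp
    (isCompact_Icc.uniformContinuousOn_of_continuous (s := Icc (0 : ℝ) 1)
      hγ.continuous.continuousOn) ε hε
  obtain ⟨n, hn⟩ := exists_nat_one_div_lt hδ
  set N := n + 1 with hN
  have hNpos : (0 : ℝ) < N := by positivity
  replace hn : 1 / (N : ℝ) < δ := by rw [hN]; exact_mod_cast hn
  set u : ℕ → ℝ := fun i => i / N with hu_def
  have hu : Monotone u := fun i j hij => by simp only [hu_def]; gcongr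
  have hu0 : ∀ i, 0 ≤ u i := fun i => by positivity
  have hu1 : ∀ i ≤ N, u i ≤ 1 := fun i hi => by
    simp only [hu_def]; rw [div_le_one hNpos]; exact_mod_cast hi
  have hstep : ∀ i, u (i + 1) = u i + 1 / N := fun i => by
    simp only [hu_def]; push_cast; ring
  -- Only cells meeting the `ε`-ball count; the mesh is below the modulus of continuity for `ε`, so
  -- each of them stays in the `2ε`-ball.
  set J := (Finset.range N).filter fun i => ∃ t ∈ Icc (u i) (u (i + 1)), ‖γ t - ξ‖ ≤ ε with hJ
  have hcover : arcCoord γ '' {t ∈ Ico (0 : ℝ) 1 | γ t ∈ {p | ‖p - ξ‖ ≤ ε}} ⊆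
      ⋃ i ∈ J, arcCoord γ '' Icc (u i) (u (i + 1)) := by
    rintro _ ⟨t, ⟨ht, htξ⟩, rfl⟩
    have htN : 0 ≤ t * N := mul_nonneg ht.1 hNpos.le
    have hmem : t ∈ Icc (u ⌊t * N⌋₊) (u (⌊t * N⌋₊ + 1)) := by
      simp only [hu_def]
      constructor
      · rw [div_le_iff₀ hNpos]; exact Nat.floor_le htN
      · rw [le_div_iff₀ hNpos]; exact_mod_cast (Nat.lt_floor_add_one _).le
    refine mem_biUnion (x := ⌊t * N⌋₊) ?_ (mem_image_of_mem _ hmem)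
    rw [Finset.mem_coe, hJ, Finset.mem_filter, Finset.mem_range, Nat.floor_lt htN]
    exact ⟨by nlinarith [ht.2], t, hmem, htξ⟩
  have hpiece : ∀ i ∈ J, volume (arcCoord γ '' Icc (u i) (u (i + 1))) ≤
      ENNReal.ofReal (72 * ε) * (eVariationOn (fun t => (l₁ t).im) (Icc (u i) (u (i + 1))) +
        eVariationOn (fun t => (l₂ t).im) (Icc (u i) (u (i + 1)))) := by
    intro i hi
    rw [hJ, Finset.mem_filter, Finset.mem_range] at hi
    obtain ⟨hiN, t, ht, htξ⟩ := hi
    have hsub : Icc (u i) (u (i + 1)) ⊆ Icc 0 1 := Icc_subset_Icc (hu0 i) (hu1 _ hiN)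
    have hball : ∀ x ∈ Icc (u i) (u (i + 1)), ‖γ x - ξ‖ ≤ 2 * ε := fun x hx => by
      have h1 : dist x t < δ := by
        refine lt_of_le_of_lt ?_ hn
        have := Real.dist_le_of_mem_Icc hx ht
        rwa [hstep, add_sub_cancel_left] at this
      have h2 := huc x (hsub hx) t (hsub ht) h1
      rw [dist_eq_norm] at h2
      have := norm_add_le (γ x - γ t) (γ t - ξ)
      rw [sub_add_sub_cancel] at this
      linarith
    refine (volume_arcCoord_image_Icc_le hγ (hu0 i) (hu (Nat.le_succ i)) (hu1 _ hiN)).trans ?_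
    refine eVariationOn_le_const_mul_add fun x hx y hy => ?_
    have := norm_sub_le_of_two_viewpoints hε (hball y hy) (hball x hx) hz₁ hz₂
      (hl₁.exp_eq y (mem_univ y)) (hl₁.exp_eq x (mem_univ x))
      (hl₂.exp_eq y (mem_univ y)) (hl₂.exp_eq x (mem_univ x))
    rw [edist_dist, edist_dist, edist_dist, ← ENNReal.ofReal_add dist_nonneg dist_nonneg,
      ← ENNReal.ofReal_mul (by positivity), dist_eq_norm, Real.dist_eq, Real.dist_eq]
    exact ENNReal.ofReal_le_ofReal this
  have hsum : ∀ g : ℝ → ℝ, ∑ i ∈ Finset.range N, eVariationOn g (Icc (u i) (u (i + 1))) =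
      eVariationOn g (Icc 0 1) := fun g => by
    rw [eVariationOn.sum' g hu]
    simp only [hu_def, Nat.cast_zero, zero_div, div_self hNpos.ne']
  calc arcMes γ {p | ‖p - ξ‖ ≤ ε}
      ≤ ∑ i ∈ J, volume (arcCoord γ '' Icc (u i) (u (i + 1))) :=
        (measure_mono hcover).trans (measure_biUnion_finset_le _ _)
    _ ≤ ∑ i ∈ J, ENNReal.ofReal (72 * ε) *
          (eVariationOn (fun t => (l₁ t).im) (Icc (u i) (u (i + 1))) +
            eVariationOn (fun t => (l₂ t).im) (Icc (u i) (u (i + 1)))) :=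
        Finset.sum_le_sum hpiece
    _ ≤ ∑ i ∈ Finset.range N, ENNReal.ofReal (72 * ε) *
          (eVariationOn (fun t => (l₁ t).im) (Icc (u i) (u (i + 1))) +
            eVariationOn (fun t => (l₂ t).im) (Icc (u i) (u (i + 1)))) :=
        Finset.sum_le_sum_of_subset (Finset.filter_subset _ _)
    _ = ENNReal.ofReal (72 * ε) * (eVariationOn (fun t => (l₁ t).im) (Icc 0 1) +
          eVariationOn (fun t => (l₂ t).im) (Icc 0 1)) := by
        rw [← Finset.mul_sum, Finset.sum_add_distrib, hsum, hsum]
    _ ≤ _ := by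
        rw [two_mul]
        gcongr

end ball

theorem proposition1 (γ : ℝ → ℂ) (hγ : IsRectifiableJordanCurve γ) (hK : KralCondition γ) :
    AhlforsRegular γ := by
  obtain ⟨M, hM0, hM⟩ := hK.exists_argVariationBound hγ
  refine ⟨144 * Real.toNNReal (6 * M + 8 * Real.pi + 4), ?_⟩
  filter_upwards [self_mem_nhdsWithin] with ε hε
  refine iSup₂_le fun ξ _ => (arcMes_closedBall_le hγ hM0 hM ξ hε).trans (le_of_eq ?_)
  rw [ENNReal.ofReal_mul (by norm_num), ENNReal.coe_mul, ENNReal.ofNNReal_toNNReal,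
    show ENNReal.ofReal 72 = 72 by simp]
  push_cast
  rw [show (144 : ℝ≥0∞) = 72 * 2 by norm_num]
  ring
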